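/- By a flat torus of dimension $n \ge 0$ we mean a metric space isometric to a quotient $\mathbb{R}^n/L$, where $L \subset \mathbb{R}^n$ is a lattice (a discrete subgroup that spans $\mathbb{R}^n$), with the distance $d([x],[y]) = \min_{l \in L} |x-y+l|$ induced by the Euclidean metric; for $n=0$ this is a single point. Let $n \ge 0$, let $(T_i)_{i\in\mathbb{N}}$ be a sequence of flat tori of dimension $n$ with $\sup_i \operatorname{diam}(T_i) < \infty$, and suppose that $T_i$ converges in the Gromov--Hausdorff distance to a compact metric space $X$. Then $X$ is isometric to a flat torus of dimension $m$ for some integer $0 \le m \le n$. -/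

import Mathlib

open Filter Topology GromovHausdorff

/-- A metric space `X` is a flat torus of dimension `n` if it is isometric to the quotient
`ℝⁿ / L` of Euclidean space by a lattice `L` (a discrete subgroup that spans `ℝⁿ`). The quotient
carries Mathlib's quotient norm, so that the distance between the classes of `x` and `y` is
`inf {‖x - y + l‖ : l ∈ L}`, which is the distance of the flat metric for which `ℝⁿ → ℝⁿ / L` is a
Riemannian covering. For `n = 0` it is a point. -/
def IsFlatTorus (n : ℕ) (X : Type*) [MetricSpace X] : Prop :=
  ∃ (L : Submodule ℤ (EuclideanSpace ℝ (Fin n))) (_ : DiscreteTopology L),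
    IsZLattice ℝ L ∧ Nonempty (X ≃ᵢ (EuclideanSpace ℝ (Fin n) ⧸ L))

open Metric

/-! Lifted to ℝⁿ, the metric of each torus is the distance to its lattice. Along an ultrafilter
these distance functions converge pointwise to the distance to a closed subgroup `H`; the diameter
bound gives lifts in a fixed ball, so nothing in `X` is missed and `X` is ℝⁿ/`H`
(`exists_closed_subgroup_of_approx`). Collapse occurs when `H` contains a nonzero linear subspace.
Let `V` be the largest one. Then ℝⁿ/`H` is Vᗮ/(H ∩ Vᗮ), where H ∩ Vᗮ contains no line, hence is
discrete, and spans Vᗮ because `X` is bounded (`exists_isFlatTorus_of_closed_subgroup`). So m = dim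
Vᗮ. -/

/-- The quotient norm on `E ⧸ L` is the distance to `L`. -/
theorem norm_quotient_mk_eq_infDist {E : Type*} [SeminormedAddCommGroup E] (L : Submodule ℤ E)
    (x : E) : ‖(Submodule.Quotient.mk x : E ⧸ L)‖ = infDist x (L : Set E) :=
  QuotientAddGroup.norm_mk (S := L.toAddSubgroup) x

theorem dist_quotient_mk_eq_infDist {E : Type*} [SeminormedAddCommGroup E] (L : Submodule ℤ E)
    (x y : E) : dist (Submodule.Quotient.mk x : E ⧸ L) (Submodule.Quotient.mk y) =
      infDist (x - y) (L : Set E) := by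
  rw [dist_eq_norm, ← Submodule.Quotient.mk_sub, norm_quotient_mk_eq_infDist]

/-- Gromov–Hausdorff close compact spaces are related by a map that almost preserves distances and
has almost dense range. -/
theorem exists_approx_isometry_of_ghDist_lt {X Y : Type*}
    [MetricSpace X] [CompactSpace X] [Nonempty X] [MetricSpace Y] [CompactSpace Y] [Nonempty Y]
    {ε : ℝ} (h : ghDist X Y < ε) :
    ∃ f : X → Y, (∀ x y, |dist (f x) (f y) - dist x y| ≤ 2 * ε) ∧
      ∀ p, ∃ x, dist (f x) p ≤ 2 * ε := by
  have hΦ := isometry_optimalGHInjl X Y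
  have hΨ := isometry_optimalGHInjr X Y
  rw [← hausdorffDist_optimal] at h
  have fin : hausdorffEDist (Set.range (optimalGHInjl X Y))
      (Set.range (optimalGHInjr X Y)) ≠ ⊤ :=
    hausdorffEDist_ne_top_of_nonempty_of_bounded (Set.range_nonempty _) (Set.range_nonempty _)
      (isCompact_range hΦ.continuous).isBounded (isCompact_range hΨ.continuous).isBounded
  have key : ∀ x, ∃ y, dist (optimalGHInjl X Y x) (optimalGHInjr X Y y) < ε := fun x => by
    obtain ⟨_, ⟨y, rfl⟩, hy⟩ :=
      exists_dist_lt_of_hausdorffDist_lt (Set.mem_range_self x) h fin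
    exact ⟨y, hy⟩
  choose f hf using key
  refine ⟨f, fun x y => ?_, fun p => ?_⟩
  · rw [← hΦ.dist_eq, ← hΨ.dist_eq, ← Real.dist_eq]
    refine (dist_dist_dist_le _ _ _ _).trans ?_
    rw [dist_comm (optimalGHInjr X Y (f x)), dist_comm (optimalGHInjr X Y (f y))]
    linarith [hf x, hf y]
  · obtain ⟨_, ⟨x, rfl⟩, hx⟩ :=
      exists_dist_lt_of_hausdorffDist_lt' (Set.mem_range_self p) h fin
    refine ⟨x, ?_⟩
    rw [← hΨ.dist_eq]
    linarith [hf x, dist_triangle_left (optimalGHInjr X Y (f x)) (optimalGHInjr X Y p)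
      (optimalGHInjl X Y x)]

/-- If the quotients `E ⧸ L i` are approximated better and better by maps into a compact space `X`,
then `X` is the quotient of `E` by a closed subgroup. -/
theorem exists_closed_subgroup_of_approx {E : Type*} [NormedAddCommGroup E] [ProperSpace E]
    {X : Type*} [MetricSpace X] [CompactSpace X] (L : ℕ → Submodule ℤ E) (f : ℕ → E → X)
    {ε : ℕ → ℝ} (hε : Tendsto ε atTop (𝓝 0)) {R : ℝ}
    (hf : ∀ i x y, |dist (f i x) (f i y) - infDist (x - y) (L i : Set E)| ≤ ε i)
    (hf' : ∀ i p, ∃ x, ‖x‖ ≤ R ∧ dist (f i x) p ≤ ε i) :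
    ∃ (H : Submodule ℤ E) (F : E → X), IsClosed (H : Set E) ∧ Function.Surjective F ∧
      ∀ x y, dist (F x) (F y) = infDist (x - y) (H : Set E) := by
  -- An ultrafilter gives limits at all points of `E` at once, without a diagonal subsequence.
  let U : Ultrafilter ℕ := hyperfilter ℕ
  have hU : (U : Filter ℕ) ≤ atTop := Nat.hyperfilter_le_atTop
  have hεU : Tendsto ε U (𝓝 0) := hε.mono_left hU
  have hlim : ∀ x, ∃ p, Tendsto (fun i => f i x) U (𝓝 p) := fun x => by
    obtain ⟨p, -, hp⟩ := isCompact_univ.ultrafilter_le_nhds (U.map fun i => f i x) (by simp)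
    exact ⟨p, hp⟩
  have hlimE : ∀ (u : ℕ → E) (r : ℝ), (∀ i, ‖u i‖ ≤ r) → ∃ x, Tendsto u U (𝓝 x) := fun u r hu => by
    obtain ⟨p, -, hp⟩ := (isCompact_closedBall (0 : E) r).ultrafilter_le_nhds (U.map u) (by
      rw [Ultrafilter.coe_map, le_principal_iff, mem_map]
      exact Filter.mem_of_superset univ_mem fun i _ => by simpa using hu i)
    exact ⟨p, hp⟩
  choose F hF using hlim
  have hdist : ∀ x y, Tendsto (fun i => infDist (x - y) (L i : Set E)) U
      (𝓝 (dist (F x) (F y))) := fun x y => by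
    refine ((hF x).dist (hF y)).congr_dist ?_
    refine squeeze_zero (fun _ => dist_nonneg) (fun i => ?_) hεU
    rw [Real.dist_eq]
    exact hf i x y
  -- The limit of the quotient norms, a seminorm on the group `E`; `H` will be its kernel.
  let N : E → ℝ := fun x => dist (F x) (F 0)
  have hN : ∀ x, Tendsto (fun i => infDist x (L i : Set E)) U (𝓝 (N x)) := fun x => by
    simpa using hdist x 0
  have hFN : ∀ x y, dist (F x) (F y) = N (x - y) := fun x y =>
    tendsto_nhds_unique (hdist x y) (hN (x - y))
  have hN_le : ∀ x, N x ≤ ‖x‖ := fun x =>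
    le_of_tendsto (hN x) (Eventually.of_forall fun i => by
      simpa using infDist_le_dist_of_mem (x := x) (L i).zero_mem)
  have hN_add : ∀ x y, N (x + y) ≤ N x + N y := fun x y =>
    le_of_tendsto_of_tendsto' (hN (x + y)) ((hN x).add (hN y)) fun i => by
      simp only [← norm_quotient_mk_eq_infDist, Submodule.Quotient.mk_add]
      exact norm_add_le _ _
  have hN_neg : ∀ x, N (-x) = N x := fun x =>
    tendsto_nhds_unique (hN (-x)) ((hN x).congr fun i => by
      simp only [← norm_quotient_mk_eq_infDist, Submodule.Quotient.mk_neg, norm_neg])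
  have hN_nonneg : ∀ x, 0 ≤ N x := fun x => dist_nonneg
  have hN_zero : N 0 = 0 := dist_self _
  have hN_sub : ∀ x y, N x ≤ N y + ‖x - y‖ := fun x y => by
    have := hN_add y (x - y)
    rw [add_sub_cancel] at this
    linarith [hN_le (x - y)]
  let H : AddSubgroup E :=
    { carrier := {x | N x = 0}
      zero_mem' := hN_zero
      add_mem' := fun {x y} hx hy => le_antisymm
        ((hN_add x y).trans (by rw [show N x = 0 from hx, show N y = 0 from hy, add_zero]))
        (hN_nonneg _)
      neg_mem' := fun {x} hx => (hN_neg x).trans hx }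
  have hN_cont : Continuous N :=
    (LipschitzWith.of_le_add fun x y => by rw [dist_eq_norm]; exact hN_sub x y).continuous
  have hN_eq : ∀ x, N x = infDist x (H : Set E) := fun x => by
    apply le_antisymm
    · refine (le_infDist ⟨0, H.zero_mem⟩).2 fun h (hh : N h = 0) => ?_
      have := hN_sub x h
      rwa [hh, zero_add, ← dist_eq_norm] at this
    · have hone : ∀ i : ℕ, (0 : ℝ) < 1 / ((i : ℝ) + 1) := fun i => by positivity
      -- Almost nearest lattice points to `x` stay bounded; their limit `z` lies in `H` and is
      -- within `N x` of `x`.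
      have : ∀ i, ∃ l ∈ (L i : Set E), dist x l < infDist x (L i : Set E) + 1 / ((i : ℝ) + 1) :=
        fun i => (infDist_lt_iff ⟨0, (L i).zero_mem⟩).1 (by linarith [hone i])
      choose l hl hxl using this
      obtain ⟨z, hz⟩ := hlimE l (‖x‖ + (‖x‖ + 1)) fun i => by
        have h1 : infDist x (L i : Set E) ≤ ‖x‖ := by
          simpa using infDist_le_dist_of_mem (x := x) (L i).zero_mem
        have h2 : 1 / ((i : ℝ) + 1) ≤ 1 := by
          rw [div_le_one (by positivity)]
          linarith [(Nat.cast_nonneg i : (0 : ℝ) ≤ i)]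
        have h3 := hxl i
        rw [dist_comm, dist_eq_norm] at h3
        have h4 := norm_le_norm_add_norm_sub' (l i) x
        linarith
      have hzH : N z = 0 := by
        refine tendsto_nhds_unique (hN z) ?_
        refine squeeze_zero (fun _ => infDist_nonneg) (fun i => infDist_le_dist_of_mem (hl i)) ?_
        simpa using (tendsto_const_nhds (x := z)).dist hz
      refine (infDist_le_dist_of_mem (show z ∈ (H : Set E) from hzH)).trans ?_
      have h5 := (hN x).add ((tendsto_one_div_add_atTop_nhds_zero_nat (𝕜 := ℝ)).mono_left hU)
      rw [add_zero] at h5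
      exact le_of_tendsto_of_tendsto' (tendsto_const_nhds.dist hz) h5 fun i => (hxl i).le
  refine ⟨AddSubgroup.toIntSubmodule H, F, isClosed_eq hN_cont continuous_const, fun p => ?_,
    fun x y => (hFN x y).trans (hN_eq _)⟩
  -- Bounded approximate lifts of `p` converge to a point that `F` sends to `p`.
  choose u hu hup using fun i => hf' i p
  obtain ⟨x, hx⟩ := hlimE u R hu
  refine ⟨x, tendsto_nhds_unique (hF x) ?_⟩
  rw [tendsto_iff_dist_tendsto_zero]
  have hsum : Tendsto (fun i => dist x (u i) + ε i + ε i) U (𝓝 0) := by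
    simpa using (((tendsto_const_nhds (x := x)).dist hx).add hεU).add hεU
  refine squeeze_zero (fun _ => dist_nonneg) (fun i => ?_) hsum
  have h1 := (abs_le.1 (hf i x (u i))).2
  have h2 : infDist (x - u i) (L i : Set E) ≤ dist x (u i) := by
    simpa [dist_eq_norm] using infDist_le_dist_of_mem (x := x - u i) (L i).zero_mem
  linarith [dist_triangle (f i x) (f i (u i)) p, hup i]

/-- A closed subgroup that contains no line is discrete. -/
theorem discreteTopology_of_isClosed_of_no_line {E : Type*} [NormedAddCommGroup E]
    [NormedSpace ℝ E] [ProperSpace E] (L : Submodule ℤ E) (hL : IsClosed (L : Set E))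
    (hline : ∀ u : E, (∀ t : ℝ, t • u ∈ L) → u = 0) : DiscreteTopology L := by
  suffices h : ∃ δ > 0, ∀ x ∈ L, ‖x‖ < δ → x = 0 by
    obtain ⟨δ, hδ, h⟩ := h
    rw [discreteTopology_iff_isOpen_singleton_zero, Metric.isOpen_singleton_iff]
    exact ⟨δ, hδ, fun y hy => Subtype.ext (h y y.2 (by simpa using hy))⟩
  by_contra! hcon
  choose x hxL hxlt hx0 using fun k : ℕ => hcon (1 / ((k : ℝ) + 1)) (by positivity)
  have hxpos : ∀ k, 0 < ‖x k‖ := fun k => norm_pos_iff.2 (hx0 k)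
  have hxlim : Tendsto (fun k => ‖x k‖) atTop (𝓝 0) :=
    squeeze_zero (fun _ => norm_nonneg _) (fun k => (hxlt k).le)
      tendsto_one_div_add_atTop_nhds_zero_nat
  obtain ⟨u, hu, φ, hφ, hlim⟩ := (isCompact_sphere (0 : E) 1).tendsto_subseq
    (x := fun k => ‖x k‖⁻¹ • x k) fun k => by
      simp [norm_smul, (hxpos k).ne']
  have hu0 : u = 0 := hline u fun t => by
    -- Integer multiples of ever shorter vectors approximate `t • u`: rounding costs less than `‖x
    -- (φ k)‖`.
    have h1 : Tendsto (fun k => (⌊t / ‖x (φ k)‖⌋ : ℤ) • x (φ k)) atTop (𝓝 (t • u)) := by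
      refine (hlim.const_smul t).congr_dist ?_
      refine squeeze_zero (fun _ => dist_nonneg) (fun k => ?_) (hxlim.comp hφ.tendsto_atTop)
      have hpos := hxpos (φ k)
      have : t • (‖x (φ k)‖⁻¹ • x (φ k)) - (⌊t / ‖x (φ k)‖⌋ : ℤ) • x (φ k) =
          Int.fract (t / ‖x (φ k)‖) • x (φ k) := by
        rw [Int.fract, sub_smul, smul_smul, div_eq_mul_inv, Int.cast_smul_eq_zsmul]
      simp only [Function.comp_apply]
      rw [dist_eq_norm, this, norm_smul, Real.norm_of_nonneg (Int.fract_nonneg _)]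
      exact mul_le_of_le_one_left hpos.le (Int.fract_lt_one _).le
    exact hL.mem_of_tendsto h1 (Eventually.of_forall fun k => L.smul_mem _ (hxL _))
  simp [hu0] at hu

/-- The largest linear subspace contained in a subgroup of a real vector space. -/
def lineSubspace {E : Type*} [AddCommGroup E] [Module ℝ E] (H : Submodule ℤ E) :
    Submodule ℝ E where
  carrier := {v | ∀ t : ℝ, t • v ∈ H}
  zero_mem' t := by simp
  add_mem' hv hw t := by
    rw [smul_add]
    exact H.add_mem (hv t) (hw t)
  smul_mem' c v hv t := by
    rw [smul_smul]
    exact hv _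

theorem norm_le_norm_sub_of_mem_orthogonal {E : Type*} [NormedAddCommGroup E]
    [InnerProductSpace ℝ E] {V : Submodule ℝ E} {v w : E} (hv : v ∈ V) (hw : w ∈ Vᗮ) :
    ‖w‖ ≤ ‖w - v‖ := by
  -- Pythagoras.
  have h := norm_sub_sq_eq_norm_sq_add_norm_sq_real (Submodule.inner_left_of_mem_orthogonal hv hw)
  nlinarith [norm_nonneg w, norm_nonneg v, norm_nonneg (w - v)]

/-- A surjection `G : E → X` whose distances are distances to a closed subgroup `L` identifies `X`
isometrically with `E ⧸ L`. -/
theorem nonempty_isometryEquiv_quotient {E X : Type*} [NormedAddCommGroup E] [MetricSpace X]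
    (L : Submodule ℤ E) (hL : IsClosed (L : Set E)) {G : E → X} (hG : Function.Surjective G)
    (hdist : ∀ x y, dist (G x) (G y) = infDist (x - y) (L : Set E)) :
    Nonempty (X ≃ᵢ (E ⧸ L)) := by
  choose σ hσ using hG
  have hiso : Isometry fun p => (Submodule.Quotient.mk (σ p) : E ⧸ L) :=
    Isometry.of_dist_eq fun p q => by
      rw [dist_quotient_mk_eq_infDist, ← hdist, hσ, hσ]
  refine ⟨⟨Equiv.ofBijective _ ⟨hiso.injective, fun z => ?_⟩, hiso⟩⟩
  obtain ⟨x, rfl⟩ := Submodule.Quotient.mk_surjective L z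
  refine ⟨G x, (Submodule.Quotient.eq L).2 ?_⟩
  have : infDist (σ (G x) - x) (L : Set E) = 0 := by rw [← hdist, hσ, dist_self]
  exact (hL.mem_iff_infDist_zero ⟨0, L.zero_mem⟩).2 this

/-- A compact quotient of a Euclidean space by a closed subgroup is a flat torus. -/
theorem exists_isFlatTorus_of_closed_subgroup {E : Type*} [NormedAddCommGroup E]
    [InnerProductSpace ℝ E] [FiniteDimensional ℝ E] {X : Type*} [MetricSpace X] [CompactSpace X]
    (H : Submodule ℤ E) (hH : IsClosed (H : Set E)) {F : E → X} (hF : Function.Surjective F)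
    (hdist : ∀ x y, dist (F x) (F y) = infDist (x - y) (H : Set E)) :
    ∃ m ≤ Module.finrank ℝ E, IsFlatTorus m X := by
  let V := lineSubspace H
  have hVH : ∀ v ∈ V, v ∈ H := fun v hv => by simpa using hv 1
  let m := Module.finrank ℝ Vᗮ
  let ι : EuclideanSpace ℝ (Fin m) →ₗᵢ[ℝ] E :=
    (Vᗮ).subtypeₗᵢ.comp (stdOrthonormalBasis ℝ Vᗮ).repr.symm.toLinearIsometry
  have hι : ∀ z, ι z ∈ Vᗮ := fun z => ((stdOrthonormalBasis ℝ Vᗮ).repr.symm z).2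
  have hdecomp : ∀ x, ∃ v ∈ V, ∃ z, x = v + ι z := fun x => by
    obtain ⟨v, hv, w, hw, rfl⟩ := V.exists_add_mem_mem_orthogonal x
    exact ⟨v, hv, (stdOrthonormalBasis ℝ Vᗮ).repr ⟨w, hw⟩, by simp [ι]⟩
  let L : Submodule ℤ (EuclideanSpace ℝ (Fin m)) := H.comap (ι.toLinearMap.restrictScalars ℤ)
  have hmem : ∀ z, z ∈ L ↔ ι z ∈ H := fun z => Iff.rfl
  have hL : IsClosed (L : Set (EuclideanSpace ℝ (Fin m))) := hH.preimage ι.continuous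
  have hinf : ∀ z, infDist (ι z) (H : Set E) = infDist z (L : Set _) := fun z => by
    apply le_antisymm
    · refine (le_infDist ⟨0, L.zero_mem⟩).2 fun l hl => ?_
      rw [← ι.dist_map]
      exact infDist_le_dist_of_mem hl
    · refine (le_infDist ⟨0, H.zero_mem⟩).2 fun h hh => ?_
      -- As `V` lies in `H`, the `V`-component of `h` can be dropped, which only brings it closer to
      -- `ι z`.
      obtain ⟨v, hv, l, rfl⟩ := hdecomp h
      have hl : l ∈ L := by
        rw [hmem]
        simpa using H.sub_mem hh (hVH v hv)
      refine (infDist_le_dist_of_mem hl).trans ?_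
      rw [dist_eq_norm, dist_eq_norm, ← ι.norm_map]
      refine (norm_le_norm_sub_of_mem_orthogonal hv (hι _)).trans_eq ?_
      rw [map_sub]
      congr 1
      abel
  have hdisc : DiscreteTopology L := discreteTopology_of_isClosed_of_no_line L hL fun u hu => by
    have huV : ι u ∈ V := fun t => by
      rw [← map_smul]
      exact hu t
    have h0 : ι u = 0 := by
      have := Submodule.inner_right_of_mem_orthogonal huV (hι u)
      exact inner_self_eq_zero.1 this
    exact ι.injective (by rw [h0, map_zero])
  have hdistG : ∀ x y, dist (F (ι x)) (F (ι y)) = infDist (x - y) (L : Set _) := fun x y => by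
    rw [hdist, ← map_sub, hinf]
  have hspan : Submodule.span ℝ (L : Set (EuclideanSpace ℝ (Fin m))) = ⊤ := by
    rw [← Submodule.orthogonal_eq_bot_iff, Submodule.eq_bot_iff]
    intro w hw
    by_contra hw0
    have hwpos : 0 < ‖w‖ := norm_pos_iff.2 hw0
    let D := diam (Set.univ : Set X)
    have hD : 0 ≤ D := diam_nonneg
    -- Orthogonal to `L`, so its distance to `L` is its length, which exceeds the diameter of `X`.
    let z := ((D + 1) / ‖w‖) • w
    have hz : ‖z‖ = D + 1 := by
      rw [norm_smul, Real.norm_of_nonneg (by positivity), div_mul_cancel₀ _ hwpos.ne']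
    have h1 : ‖z‖ ≤ infDist z (L : Set _) := by
      refine (le_infDist ⟨0, L.zero_mem⟩).2 fun l hl => ?_
      rw [dist_eq_norm]
      exact norm_le_norm_sub_of_mem_orthogonal (Submodule.subset_span hl)
        (Submodule.smul_mem _ _ hw)
    have h2 : infDist z (L : Set _) ≤ D := by
      have := hdistG z 0
      rw [sub_zero] at this
      rw [← this]
      exact dist_le_diam_of_mem isCompact_univ.isBounded trivial trivial
    linarith
  have hG : Function.Surjective (F ∘ ι) := fun p => by
    obtain ⟨x, rfl⟩ := hF p
    obtain ⟨v, hv, z, rfl⟩ := hdecomp x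
    refine ⟨z, dist_eq_zero.1 ?_⟩
    rw [Function.comp_apply, hdist]
    refine (hH.mem_iff_infDist_zero ⟨0, H.zero_mem⟩).1 ?_
    simpa using hVH v hv
  exact ⟨m, Submodule.finrank_le _, L, hdisc, ⟨hspan⟩,
    nonempty_isometryEquiv_quotient L hL hG hdistG⟩

theorem mainTheorem5 {n : ℕ}
    (T : ℕ → Type*) [∀ i, MetricSpace (T i)] [∀ i, CompactSpace (T i)] [∀ i, Nonempty (T i)]
    (hT : ∀ i, IsFlatTorus n (T i))
    (hdiam : ∃ D : ℝ, ∀ i, Metric.diam (Set.univ : Set (T i)) ≤ D)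
    (X : Type*) [MetricSpace X] [CompactSpace X] [Nonempty X]
    (hlim : Tendsto (fun i => ghDist (T i) X) atTop (𝓝 0)) :
    ∃ m : ℕ, m ≤ n ∧ IsFlatTorus m X := by
  obtain ⟨D, hD⟩ := hdiam
  choose L _ _ e using hT
  let E := EuclideanSpace ℝ (Fin n)
  let e := fun i => (e i).some
  -- The added term makes the bound on `ghDist` strict.
  let ε : ℕ → ℝ := fun i => ghDist (T i) X + 1 / ((i : ℝ) + 1)
  have hε : ∀ i, ghDist (T i) X < ε i := fun i => lt_add_of_pos_right _ (by positivity)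
  have hε0 : Tendsto (fun i => 2 * ε i) atTop (𝓝 0) := by
    simpa [ε] using (hlim.add (tendsto_one_div_add_atTop_nhds_zero_nat (𝕜 := ℝ))).const_mul 2
  choose g hg hg' using fun i => exists_approx_isometry_of_ghDist_lt (hε i)
  let π : ∀ i, E → T i := fun i x => (e i).symm (Submodule.Quotient.mk x)
  have hπ : ∀ i x y, dist (π i x) (π i y) = infDist (x - y) (L i : Set E) := fun i x y => by
    rw [(e i).symm.dist_eq, dist_quotient_mk_eq_infDist]
  have hπ' : ∀ i p, ∃ x, ‖x‖ ≤ D + 1 ∧ π i x = p := fun i p => by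
    obtain ⟨y, hy⟩ := Submodule.Quotient.mk_surjective (L i) (e i p)
    have h1 : infDist y (L i : Set E) ≤ D := by
      have := hπ i y 0
      rw [sub_zero] at this
      rw [← this]
      exact (dist_le_diam_of_mem isCompact_univ.isBounded trivial trivial).trans (hD i)
    -- The slack 1 avoids needing a nearest lattice point.
    obtain ⟨l, hl, hyl⟩ := (infDist_lt_iff (x := y) (r := D + 1) ⟨0, (L i).zero_mem⟩).1
      (h1.trans_lt (lt_add_one D))
    refine ⟨y - l, by rw [← dist_eq_norm]; exact hyl.le, ?_⟩
    have : (Submodule.Quotient.mk (y - l) : E ⧸ L i) = e i p := by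
      rw [← hy, Submodule.Quotient.eq, sub_sub_cancel_left]
      exact (L i).neg_mem hl
    simp only [π, this, IsometryEquiv.symm_apply_apply]
  obtain ⟨H, F, hH, hF, hdist⟩ := exists_closed_subgroup_of_approx (E := E) (X := X) L
    (fun i x => g i (π i x)) hε0 (R := D + 1)
    (fun i x y => by rw [← hπ]; exact hg i _ _)
    (fun i p => by
      obtain ⟨q, hq⟩ := hg' i p
      obtain ⟨x, hx, rfl⟩ := hπ' i q
      exact ⟨x, hx, hq⟩)
  obtain ⟨m, hm, hX⟩ := exists_isFlatTorus_of_closed_subgroup H hH hF hdist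
  exact ⟨m, by simpa [E] using hm, hX⟩
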